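/- A state of a quantum system with Hilbert space $\mathbb C^n$ is a positive semidefinite complex $n\times n$ matrix of trace one. For a vector $\lambda=(\lambda_1,\dots,\lambda_n)$ with non-negative entries put $$F(\lambda) = -\sum_{i=1}^n \frac{\lambda_i^n}{\prod_{j\neq i}(\lambda_i-\lambda_j)}\,\ln\lambda_i ,$$ where, if entries of $\lambda$ coincide or vanish, $F(\lambda)$ denotes the limit of this expression along vectors with positive, pairwise distinct entries tending to $\lambda$. The subentropy of a state $\rho$ is $Q(\rho)=F(\lambda)$, where $\lambda$ is the vector of eigenvalues of $\rho$ listed with multiplicity. For a state $\rho_{AB}$ on $\mathcal H_A\otimes\mathcal H_B$ with reduced state $\rho_B=\operatorname{Tr}_A\rho_{AB}$, the conditional subentropy is $Q(A|B)_\rho = Q(\rho_{AB})-Q(\rho_B)$. Proposition. Let $\mathcal H_X$ and $\mathcal H_B$ be finite-dimensional complex Hilbert spaces and let $\rho_{XB}$ be a classical-quantum state on $\mathcal H_X\otimes\mathcal H_B$, that is, a state of the form $\rho_{XB}=\sum_{x=1}^N p_x\,|x\rangle\langle x|\otimes\rho_B^x$, where $(p_x)$ is a probability distribution, $\{|x\rangle\}$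 is an orthonormal set in $\mathcal H_X$ (not necessarily a basis), and each $\rho_B^x$ is a state on $\mathcal H_B$. Then the limits defining $Q(\rho_{XB})$ and $Q(\rho_B)$ exist and are finite, and $$Q(X|B)_\rho = Q(\rho_{XB})-Q(\rho_B)\ \ge\ 0 .$$ -/

import Mathlib

open Filter Topology
open scoped Kronecker ComplexOrder

noncomputable section

namespace Subentropy

/-- The explicit expression
`- ∑ i, λ i ^ n / ∏ j ≠ i, (λ i - λ j) * ln (λ i)`, where `n` is the number of entries of `λ`.
It is the intended value when the entries are positive and pairwise distinct. -/
def rawF {ι : Type*} [Fintype ι] [DecidableEq ι] (lam : ι → ℝ) : ℝ :=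
  - ∑ i, lam i ^ Fintype.card ι / (∏ j ∈ Finset.univ.erase i, (lam i - lam j)) * Real.log (lam i)

/-- The vectors on which `rawF` is free of singularities: positive, pairwise distinct entries. -/
def regularVectors (ι : Type*) : Set (ι → ℝ) :=
  {lam | Function.Injective lam ∧ ∀ i, 0 < lam i}

/-- `HasF lam q`: the expression `rawF` tends to the finite limit `q` at `lam`, along vectors with
positive, pairwise distinct entries. -/
def HasF {ι : Type*} [Fintype ι] [DecidableEq ι] (lam : ι → ℝ) (q : ℝ) : Prop :=
  Tendsto rawF (𝓝[regularVectors ι] lam) (𝓝 q)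

/-- The subentropy function `F` of a vector: the limit of the explicit expression along vectors
with positive, pairwise distinct entries. (At a vector that itself has positive, pairwise distinct
entries the expression is continuous, so the limit is its value.) -/
def F {ι : Type*} [Fintype ι] [DecidableEq ι] (lam : ι → ℝ) : ℝ :=
  limUnder (𝓝[regularVectors ι] lam) rawF

/-- A state of a quantum system with Hilbert space `ℂ^n`: a positive semidefinite matrix
of trace one. -/
structure State (n : Type*) [Fintype n] where
  mat : Matrix n n ℂ
  posSemidef : mat.PosSemidef
  trace_eq_one : mat.trace = 1

variable {n a b : Type*} [Fintype n] [Fintype a] [Fintype b]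

/-- The eigenvalues of a state, with multiplicity. -/
def State.eigenvalues [DecidableEq n] (ρ : State n) : n → ℝ :=
  ρ.posSemidef.isHermitian.eigenvalues

/-- The subentropy `Q(ρ)`. -/
def Q [DecidableEq n] (ρ : State n) : ℝ := F ρ.eigenvalues

/-- The reduced state `ρ_B = Tr_A ρ_AB` of a bipartite state. -/
def State.reduced (ρ : State (a × b)) : State b where
  mat := ∑ i : a, ρ.mat.submatrix (fun j => (i, j)) (fun j => (i, j))
  posSemidef := Matrix.posSemidef_sum _ fun _ _ => ρ.posSemidef.submatrix _
  trace_eq_one := by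
    rw [Matrix.trace_sum, ← ρ.trace_eq_one]
    simp [Matrix.trace, Fintype.sum_prod_type]

/-- The conditional subentropy `Q(A|B)_ρ = Q(ρ_AB) - Q(ρ_B)`. -/
def condQ [DecidableEq a] [DecidableEq b] (ρ : State (a × b)) : ℝ := Q ρ - Q ρ.reduced

/-- The rank-one matrix `|v⟩⟨v|`. -/
def proj (v : EuclideanSpace ℂ a) : Matrix a a ℂ := Matrix.vecMulVec v.ofLp (star v.ofLp)

/-- `ρ` is a classical-quantum state: `ρ = ∑ x, p x |x⟩⟨x| ⊗ σ x` for a probability distribution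
`p`, orthonormal vectors `|x⟩` (not necessarily a basis) of the first space, and states `σ x` of
the second. -/
def IsClassicalQuantum (ρ : State (a × b)) : Prop :=
  ∃ (N : ℕ) (p : Fin N → ℝ) (e : Fin N → EuclideanSpace ℂ a) (σ : Fin N → State b),
    (∀ x, 0 ≤ p x) ∧ ∑ x, p x = 1 ∧ Orthonormal ℂ e ∧
      ρ.mat = ∑ x, (p x : ℂ) • (proj (e x) ⊗ₖ (σ x).mat)

end Subentropy

end

namespace Subentropy

/-! For positive distinct entries, partial fractions turn the divided-difference formula into `F(λ)
= ∫₀^∞ (1 - s/(1+t) - ∏ (1 + λ_i/t)⁻¹) dt` with `s = ∑ λ_i`; the term `s/(1+t)` cancels the `1/t`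
tail. The integral makes sense for all non-negative entries and is continuous there, so the limits
exist (`hasF_integralF`). The product is `det (1 + ρ/t)`, and all states have `s = 1`, so it
suffices to compare determinants pointwise in `t`. With `u = 1/t`, orthonormality gives `det (1 + u
ρ_XB) = ∏ det (1 + u p_x σ_x)`, which dominates `det (1 + u ∑ p_x σ_x) = det (1 + u ρ_B)` because
`det (1 + A + B) ≤ det (1 + A) det (1 + B)` for positive semidefinite `A`, `B`. -/

/-- The integrand of the integral representation of the subentropy function. -/
noncomputable def integrand {ι : Type*} [Fintype ι] (lam : ι → ℝ) (t : ℝ) : ℝ :=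
  1 - (∑ i, lam i) / (1 + t) - (∏ i, (1 + lam i / t))⁻¹

/-- The integral representation of the subentropy function. -/
noncomputable def integralF {ι : Type*} [Fintype ι] (lam : ι → ℝ) : ℝ :=
  ∫ t in Set.Ioi (0 : ℝ), integrand lam t

/-! ### Integral representation of the subentropy function and existence of the limits. -/

section Analysis

open MeasureTheory Polynomial

variable {ι : Type*} [Fintype ι]

theorem one_add_sum_le_prod_one_add {ι : Type*} {x : ι → ℝ} (hx : ∀ i, 0 ≤ x i) (s : Finset ι) :
    1 + ∑ i ∈ s, x i ≤ ∏ i ∈ s, (1 + x i) := by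
  classical
  induction s using Finset.induction_on with
  | empty => simp
  | insert i s hi ih =>
    rw [Finset.sum_insert hi, Finset.prod_insert hi]
    have h0 := hx i
    have h1 : 0 ≤ ∑ i ∈ s, x i := Finset.sum_nonneg fun i _ => hx i
    nlinarith [mul_nonneg h0 h1]

theorem prod_one_add_le_exp_sum {x : ι → ℝ} (hx : ∀ i, 0 ≤ x i) :
    ∏ i, (1 + x i) ≤ Real.exp (∑ i, x i) := by
  rw [Real.exp_sum]
  refine Finset.prod_le_prod (fun i _ => by linarith [hx i]) fun i _ => ?_
  linarith [Real.add_one_le_exp (x i)]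

/-- The bound depends on `lam` only through its sum, so it also dominates the integrands locally
uniformly in `lam`. -/
theorem abs_integrand_le {lam : ι → ℝ} (h : ∀ i, 0 ≤ lam i) {t : ℝ} (ht : 0 < t) :
    |integrand lam t| ≤ (1 + 2 * ∑ i, lam i + (∑ i, lam i) ^ 2) * (1 + t ^ 2)⁻¹ := by
  have hx : ∀ i, 0 ≤ lam i / t := fun i => div_nonneg (h i) ht.le
  have h1 := one_add_sum_le_prod_one_add hx Finset.univ
  have h2 := prod_one_add_le_exp_sum hx
  rw [← Finset.sum_div] at h1 h2
  have hs : 0 ≤ ∑ i, lam i := Finset.sum_nonneg fun i _ => h i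
  unfold integrand
  set s := ∑ i, lam i
  set P := ∏ i, (1 + lam i / t)
  have hst : 0 ≤ s / t := div_nonneg hs ht.le
  have hP : 1 ≤ P := by linarith
  have hP0 : 0 < P := by linarith
  have hPi : P⁻¹ ≤ 1 := inv_le_one_of_one_le₀ hP
  have hPi0 : 0 < P⁻¹ := inv_pos.2 hP0
  have hlow : 1 - s / t ≤ P⁻¹ := by
    have h3 : Real.exp (-(s / t)) ≤ P⁻¹ := by
      rw [Real.exp_neg]
      exact inv_anti₀ hP0 h2
    linarith [Real.add_one_le_exp (-(s / t))]
  have hup : P⁻¹ ≤ 1 - s / t + (s / t) ^ 2 := by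
    have h3 : P⁻¹ ≤ (1 + s / t)⁻¹ := inv_anti₀ (by linarith) h1
    have h4 : (1 + s / t)⁻¹ ≤ 1 - s / t + (s / t) ^ 2 := by
      rw [inv_le_iff_one_le_mul₀ (by linarith)]
      nlinarith [pow_nonneg hst 3]
    linarith
  have ha0 : 0 ≤ s / (1 + t) := by positivity
  have has : s / (1 + t) ≤ s := div_le_self hs (by linarith)
  have hd : s / t - s / (1 + t) = (s / t ^ 2) * (t / (1 + t)) := by
    field_simp
    ring
  have hr : t / (1 + t) ≤ 1 := (div_le_one (by linarith)).2 (by linarith)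
  have hr0 : 0 ≤ t / (1 + t) := by positivity
  have hst2 : 0 ≤ s / t ^ 2 := by positivity
  have hd0 : 0 ≤ s / t - s / (1 + t) := by rw [hd]; positivity
  have hd1 : s / t - s / (1 + t) ≤ s / t ^ 2 := by rw [hd]; nlinarith
  have hA : |1 - s / (1 + t) - P⁻¹| ≤ 1 + s := abs_le.2 ⟨by linarith, by linarith⟩
  have hB : |1 - s / (1 + t) - P⁻¹| ≤ (s + s ^ 2) / t ^ 2 := by
    have : (s + s ^ 2) / t ^ 2 = s / t ^ 2 + (s / t) ^ 2 := by rw [div_pow, add_div]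
    rw [this]
    exact abs_le.2 ⟨by nlinarith [sq_nonneg (s / t)], by nlinarith [sq_nonneg (s / t)]⟩
  -- Adding `hA` to `t ^ 2` times the estimate `hB` produces the constant `(1 + s) + (s + s ^ 2)`.
  rw [le_div_iff₀ (by positivity)] at hB
  rw [← div_eq_mul_inv, le_div_iff₀ (by positivity)]
  linarith

theorem integrable_integrand {lam : ι → ℝ} (h : ∀ i, 0 ≤ lam i) :
    IntegrableOn (integrand lam) (Set.Ioi 0) := by
  refine Integrable.mono'
    ((integrable_inv_one_add_sq.const_mul _).integrableOn (s := Set.Ioi 0)) ?_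
    ((ae_restrict_iff' measurableSet_Ioi).2 (ae_of_all _ fun t ht => abs_integrand_le h ht))
  unfold integrand
  fun_prop

theorem continuousWithinAt_integralF {lam : ι → ℝ} (h : ∀ i, 0 ≤ lam i) :
    ContinuousWithinAt integralF {mu : ι → ℝ | ∀ i, 0 ≤ mu i} lam := by
  have hev : ∀ᶠ mu in 𝓝[{mu : ι → ℝ | ∀ i, 0 ≤ mu i}] lam, ∑ i, mu i < ∑ i, lam i + 1 := by
    have hc : Continuous fun mu : ι → ℝ => ∑ i, mu i := by fun_prop
    exact nhdsWithin_le_nhds (hc.continuousAt.eventually_lt_const (by linarith))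
  set S := ∑ i, lam i + 1
  refine continuousWithinAt_of_dominated
    (bound := fun t => (1 + 2 * S + S ^ 2) * (1 + t ^ 2)⁻¹) ?_ ?_
    (integrable_inv_one_add_sq.const_mul _).integrableOn ?_
  · exact eventually_nhdsWithin_of_forall fun mu hmu =>
      (integrable_integrand hmu).aestronglyMeasurable
  · filter_upwards [hev, self_mem_nhdsWithin] with mu hlt hmu
    refine (ae_restrict_iff' measurableSet_Ioi).2 (ae_of_all _ fun t ht => ?_)
    refine (abs_integrand_le hmu ht).trans ?_
    have h0 : 0 ≤ ∑ i, mu i := Finset.sum_nonneg fun i _ => hmu i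
    gcongr
  · refine (ae_restrict_iff' measurableSet_Ioi).2 (ae_of_all _ fun t ht => ?_)
    have ht : 0 < t := ht
    have hp : ∏ i, (1 + lam i / t) ≠ 0 := Finset.prod_ne_zero_iff.2 fun i _ => by
      have := div_nonneg (h i) ht.le
      linarith
    have : ContinuousAt (fun mu : ι → ℝ => integrand mu t) lam := by
      unfold integrand
      refine ContinuousAt.sub (by fun_prop) (ContinuousAt.inv₀ ?_ hp)
      have hc : ∀ i, Continuous fun mu : ι → ℝ => 1 + mu i / t := fun i =>
        continuous_const.add ((continuous_apply i : Continuous fun mu : ι → ℝ => mu i).div_const t)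
      exact (continuous_finsetProd _ fun i _ => hc i).continuousAt
    exact this.continuousWithinAt

/-- Needed for `limUnder` to be determined by convergence. Perturb along `lam + ε v` with `v`
positive and injective: each pair of indices collides for at most one `ε`. -/
theorem neBot_nhdsWithin_regularVectors {lam : ι → ℝ} (h : ∀ i, 0 ≤ lam i) :
    (𝓝[regularVectors ι] lam).NeBot := by
  classical
  set e := Fintype.equivFin ι
  set v : ι → ℝ := fun i => (e i : ℝ) + 1
  have hv : ∀ i, 0 < v i := fun i => by positivity
  have hinj : ∀ i j, i ≠ j → v i ≠ v j := fun i j hij hvij => hij <| by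
    simpa [v, Fin.val_inj] using hvij
  have ht : Tendsto (fun ε : ℝ => fun i => lam i + ε * v i) (𝓝[>] 0)
      (𝓝[regularVectors ι] lam) := by
    refine tendsto_nhdsWithin_iff.2 ⟨?_, ?_⟩
    · have : Continuous fun ε : ℝ => fun i => lam i + ε * v i := by fun_prop
      simpa using (this.tendsto 0).mono_left nhdsWithin_le_nhds
    · have hne : ∀ i j, ∀ᶠ ε in 𝓝[>] (0 : ℝ), i ≠ j →
          lam i + ε * v i ≠ lam j + ε * v j := by
        intro i j
        by_cases hij : i = j
        · simp [hij]
        have hvd : v i - v j ≠ 0 := sub_ne_zero.2 (hinj i j hij)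
        have h1 : ∀ᶠ ε in 𝓝[>] (0 : ℝ), ε ≠ (lam j - lam i) / (v i - v j) := by
          by_cases h0 : (lam j - lam i) / (v i - v j) = 0
          · rw [h0]
            exact eventually_nhdsWithin_of_forall fun ε hε => ne_of_gt hε
          · exact nhdsWithin_le_nhds (isOpen_ne.mem_nhds (Ne.symm h0))
        filter_upwards [h1] with ε hε _ heq
        exact hε ((eq_div_iff hvd).2 (by linarith))
      have hall : ∀ᶠ ε in 𝓝[>] (0 : ℝ), ∀ i j, i ≠ j →
          lam i + ε * v i ≠ lam j + ε * v j :=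
        eventually_all.2 fun i => eventually_all.2 fun j => hne i j
      filter_upwards [hall, self_mem_nhdsWithin] with ε hε hpos
      refine ⟨fun i j hij => ?_, fun i => ?_⟩
      · by_contra hne
        exact hε i j hne hij
      · exact add_pos_of_nonneg_of_pos (h i) (mul_pos hpos (hv i))
  exact ht.neBot

/-- With the evaluation lemma below, this identifies `X ^ n - nodal` as the Lagrange interpolant of
the values `lam i ^ n`, `n` being the number of entries. -/
theorem degree_X_pow_sub_nodal_lt (lam : ι → ℝ) :
    (X ^ Fintype.card ι - Lagrange.nodal Finset.univ lam).degree
      < ((Finset.univ : Finset ι).card : WithBot ℕ) := by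
  have h1 : (X ^ Fintype.card ι : ℝ[X]).degree = (Finset.univ : Finset ι).card := by
    simp
  have h2 : (Lagrange.nodal (Finset.univ : Finset ι) lam).degree
      = (Finset.univ : Finset ι).card := Lagrange.degree_nodal
  refine (degree_sub_lt_left (h1.trans h2.symm) (pow_ne_zero _ X_ne_zero) ?_).trans_eq h1
  rw [(monic_X_pow _).leadingCoeff, Lagrange.nodal_monic.leadingCoeff]

theorem eval_X_pow_sub_nodal (lam : ι → ℝ) (i : ι) :
    (X ^ Fintype.card ι - Lagrange.nodal Finset.univ lam).eval (lam i)
      = lam i ^ Fintype.card ι := by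
  classical
  simp [Lagrange.eval_nodal_at_node]

variable [DecidableEq ι]

/-- Both sides are the coefficient of `X ^ (n - 1)` in `X ^ n - nodal`, read off from the Lagrange
form and from Vieta. -/
theorem sum_pow_card_div_prod_sub {lam : ι → ℝ} (hinj : Function.Injective lam) :
    ∑ i, lam i ^ Fintype.card ι / ∏ j ∈ Finset.univ.erase i, (lam i - lam j)
      = ∑ i, lam i := by
  rcases isEmpty_or_nonempty ι with hι | hι
  · simp
  have h := Lagrange.coeff_eq_sum hinj.injOn (degree_X_pow_sub_nodal_lt lam)
  simp only [eval_X_pow_sub_nodal] at h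
  have hc : 0 < (Finset.univ : Finset ι).card := Finset.card_pos.2 Finset.univ_nonempty
  rw [← h, coeff_sub, Lagrange.nodal, prod_X_sub_C_coeff_card_pred _ _ hc, coeff_X_pow,
    if_neg (by rw [Finset.card_univ] at *; omega)]
  ring

/-- Partial fractions: evaluate the same interpolant at `-t` and divide by `nodal (-t)`. -/
theorem one_sub_inv_prod_one_add_div {lam : ι → ℝ} (hlam : lam ∈ regularVectors ι) {t : ℝ}
    (ht : 0 < t) :
    1 - (∏ i, (1 + lam i / t))⁻¹
      = ∑ i, lam i ^ Fintype.card ι / (∏ j ∈ Finset.univ.erase i, (lam i - lam j))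
          * (t + lam i)⁻¹ := by
  have hpos := hlam.2
  have hpol := Lagrange.eq_interpolate_of_eval_eq (fun i => lam i ^ Fintype.card ι)
    hlam.1.injOn (degree_X_pow_sub_nodal_lt lam) fun i _ => eval_X_pow_sub_nodal lam i
  have h := congrArg (eval (-t)) hpol
  rw [Lagrange.eval_interpolate_not_at_node _ fun i _ => by linarith [hpos i]] at h
  have hn : eval (-t) (Lagrange.nodal Finset.univ lam)
      = (-t) ^ Fintype.card ι * ∏ i, (1 + lam i / t) := by
    rw [Lagrange.eval_nodal, Fintype.card, ← Finset.prod_const, ← Finset.prod_mul_distrib]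
    refine Finset.prod_congr rfl fun i _ => ?_
    field_simp
    ring
  have hP : ∏ i, (1 + lam i / t) ≠ 0 := Finset.prod_ne_zero_iff.2 fun i _ => by
    have := div_pos (hpos i) ht
    linarith
  have ht' : (-t) ^ Fintype.card ι ≠ 0 := pow_ne_zero _ (by linarith)
  have hsum : ∑ i, Lagrange.nodalWeight Finset.univ lam i * (-t - lam i)⁻¹
        * lam i ^ Fintype.card ι
      = -∑ i, lam i ^ Fintype.card ι / (∏ j ∈ Finset.univ.erase i, (lam i - lam j))
          * (t + lam i)⁻¹ := by
    rw [← Finset.sum_neg_distrib]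
    refine Finset.sum_congr rfl fun i _ => ?_
    rw [Lagrange.nodalWeight, Finset.prod_inv_distrib, show -t - lam i = -(t + lam i) by ring,
      inv_neg]
    ring
  rw [hsum, hn] at h
  simp only [eval_sub, eval_pow, eval_X, hn] at h
  have h' : 1 - ∏ i, (1 + lam i / t) = (∏ i, (1 + lam i / t)) *
      -∑ i, lam i ^ Fintype.card ι / (∏ j ∈ Finset.univ.erase i, (lam i - lam j))
          * (t + lam i)⁻¹ := by
    refine mul_left_cancel₀ ht' ?_
    linear_combination h
  refine mul_left_cancel₀ hP ?_
  rw [mul_sub, mul_inv_cancel₀ hP]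
  linear_combination -h'

theorem rawF_eq_integralF {lam : ι → ℝ} (hlam : lam ∈ regularVectors ι) :
    rawF lam = integralF lam := by
  have hpos := hlam.2
  set c : ι → ℝ := fun i =>
    lam i ^ Fintype.card ι / ∏ j ∈ Finset.univ.erase i, (lam i - lam j) with hc
  have hcs : ∑ i, c i = ∑ i, lam i := sum_pow_card_div_prod_sub hlam.1
  -- Since `∑ c i = ∑ lam i`, the subtracted logarithms account for the `1/(1+t)` term. This
  -- antiderivative vanishes at infinity and equals `-rawF lam` at `0`.
  have hderiv : ∀ t ∈ Set.Ioi (0 : ℝ), HasDerivAt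
      (fun t => ∑ i, c i * (Real.log (t + lam i) - Real.log (1 + t))) (integrand lam t) t := by
    intro t ht
    have ht : 0 < t := ht
    have heq : integrand lam t = ∑ i, c i * (1 / (t + lam i) - 1 / (1 + t)) := by
      rw [integrand, sub_right_comm, one_sub_inv_prod_one_add_div hlam ht, ← hcs,
        Finset.sum_div, ← Finset.sum_sub_distrib]
      refine Finset.sum_congr rfl fun i _ => ?_
      simp only [hc]
      ring
    rw [heq]
    refine HasDerivAt.fun_sum fun i _ => HasDerivAt.const_mul _ (HasDerivAt.sub ?_ ?_)
    · exact ((hasDerivAt_id t).add_const (lam i)).log (by simpa using by linarith [hpos i])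
    · exact ((hasDerivAt_id t).const_add 1).log (by simpa using by linarith)
  have hcont : ContinuousWithinAt
      (fun t => ∑ i, c i * (Real.log (t + lam i) - Real.log (1 + t))) (Set.Ici 0) 0 := by
    refine ContinuousAt.continuousWithinAt ?_
    refine tendsto_finsetSum _ fun i _ => ?_
    have h1 : ContinuousAt (fun t : ℝ => Real.log (t + lam i)) 0 :=
      ContinuousAt.log (by fun_prop) (by simpa using (hpos i).ne')
    have h2 : ContinuousAt (fun t : ℝ => Real.log (1 + t)) 0 :=
      ContinuousAt.log (by fun_prop) (by simp)
    exact (h1.sub h2).const_mul (c i)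
  have hlim : Tendsto (fun t => ∑ i, c i * (Real.log (t + lam i) - Real.log (1 + t))) atTop
      (𝓝 0) := by
    have h1 : ∀ i, Tendsto (fun t => c i * (Real.log (t + lam i) - Real.log (1 + t))) atTop
        (𝓝 (c i * (0 - 0))) := by
      intro i
      have h2 := (Real.tendsto_log_comp_add_sub_log (lam i)).sub
        (Real.tendsto_log_comp_add_sub_log 1)
      refine (h2.congr fun t => ?_).const_mul (c i)
      rw [add_comm t 1]
      ring
    simpa using tendsto_finsetSum Finset.univ fun i _ => h1 i
  rw [integralF, integral_Ioi_of_hasDerivAt_of_tendsto hcont hderiv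
    (integrable_integrand fun i => (hpos i).le) hlim]
  simp [rawF, hc]

theorem hasF_integralF {lam : ι → ℝ} (h : ∀ i, 0 ≤ lam i) : HasF lam (integralF lam) := by
  have h1 : Tendsto integralF (𝓝[regularVectors ι] lam) (𝓝 (integralF lam)) :=
    (continuousWithinAt_integralF h).mono fun mu hmu i => (hmu.2 i).le
  exact h1.congr' (eventually_nhdsWithin_of_forall fun mu hmu => (rawF_eq_integralF hmu).symm)

theorem F_eq_integralF {lam : ι → ℝ} (h : ∀ i, 0 ≤ lam i) : F lam = integralF lam :=
  have := neBot_nhdsWithin_regularVectors h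
  (hasF_integralF h).limUnder_eq

end Analysis

/-! ### Determinant inequalities and the determinant of a classical-quantum matrix. -/

section Determinant

open Matrix

variable {n : Type*} [Fintype n] [DecidableEq n]

theorem det_one_add_inv_smul {A : Matrix n n ℂ} (hA : A.IsHermitian) {t : ℝ} (ht : 0 < t) :
    (1 + ((t⁻¹ : ℝ) : ℂ) • A).det = ((∏ i, (1 + hA.eigenvalues i / t) : ℝ) : ℂ) := by
  have htc : (t : ℂ) ≠ 0 := Complex.ofReal_ne_zero.2 ht.ne'
  -- The characteristic polynomial at `-t` is `det (-t - A) = (-t) ^ n * det (1 + A / t)`.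
  have h := congrArg (Polynomial.eval (-(t : ℂ))) hA.charpoly_eq
  rw [Matrix.eval_charpoly, Polynomial.eval_prod] at h
  have h1 : Matrix.scalar n (-(t : ℂ)) - A = (-(t : ℂ)) • (1 + ((t⁻¹ : ℝ) : ℂ) • A) := by
    rw [smul_add, smul_smul, Complex.ofReal_inv, neg_mul, mul_inv_cancel₀ htc, neg_one_smul,
      ← sub_eq_add_neg, Matrix.scalar_apply, ← Matrix.smul_one_eq_diagonal]
  have h2 : ∏ i, Polynomial.eval (-(t : ℂ))
        (Polynomial.X - Polynomial.C ((hA.eigenvalues i : ℝ) : ℂ))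
      = (-(t : ℂ)) ^ Fintype.card n * ((∏ i, (1 + hA.eigenvalues i / t) : ℝ) : ℂ) := by
    rw [Fintype.card, ← Finset.prod_const, Complex.ofReal_prod, ← Finset.prod_mul_distrib]
    refine Finset.prod_congr rfl fun i _ => ?_
    simp only [Polynomial.eval_sub, Polynomial.eval_X, Polynomial.eval_C]
    push_cast
    field_simp
    ring
  rw [h1, Matrix.det_smul] at h
  exact mul_left_cancel₀ (pow_ne_zero _ (neg_ne_zero.2 htc)) (h.trans h2)

theorem one_le_det_one_add {A : Matrix n n ℂ} (hA : A.PosSemidef) : 1 ≤ (1 + A).det := by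
  have h := det_one_add_inv_smul hA.isHermitian one_pos
  simp only [inv_one, Complex.ofReal_one, one_smul, div_one] at h
  rw [h, ← Complex.ofReal_one, Complex.real_le_real]
  have hx : ∀ i, 0 ≤ hA.isHermitian.eigenvalues i := hA.eigenvalues_nonneg
  refine le_trans ?_ (one_add_sum_le_prod_one_add hx Finset.univ)
  linarith [Finset.sum_nonneg fun i (_ : i ∈ Finset.univ) => hx i]

open scoped MatrixOrder Matrix.Norms.L2Operator in
theorem exists_eq_conjTranspose_mul_self {A : Matrix n n ℂ} (hA : A.PosSemidef) :
    ∃ C : Matrix n n ℂ, A = Cᴴ * C :=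
  CStarAlgebra.nonneg_iff_eq_star_mul_self.1 hA.nonneg

theorem det_add_conjTranspose_mul_self {M : Matrix n n ℂ} (hM : M.PosDef) (C : Matrix n n ℂ) :
    (M + Cᴴ * C).det = M.det * (1 + C * M⁻¹ * Cᴴ).det := by
  have hu : IsUnit M.det := hM.det_pos.ne'.isUnit
  have h : M + Cᴴ * C = M * (1 + (M⁻¹ * Cᴴ) * C) := by
    rw [mul_add, mul_one, ← Matrix.mul_assoc, ← Matrix.mul_assoc, Matrix.mul_nonsing_inv M hu,
      Matrix.one_mul]
  rw [h, Matrix.det_mul, Matrix.det_one_add_mul_comm, Matrix.mul_assoc]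

theorem det_le_det_add {P K : Matrix n n ℂ} (hP : P.PosDef) (hK : K.PosSemidef) :
    P.det ≤ (P + K).det := by
  obtain ⟨C, rfl⟩ := exists_eq_conjTranspose_mul_self hK
  rw [det_add_conjTranspose_mul_self hP]
  exact le_mul_of_one_le_right hP.det_pos.le
    (one_le_det_one_add (hP.inv.posSemidef.mul_mul_conjTranspose_same C))

/-- The difference equals `(1 + A)⁻¹ (A + A²) (1 + A)⁻¹`. -/
theorem posSemidef_one_sub_inv_one_add {A : Matrix n n ℂ} (hA : A.PosSemidef) :
    (1 - (1 + A)⁻¹).PosSemidef := by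
  have hM : (1 + A).PosDef := PosDef.one.add_posSemidef hA
  have hu : IsUnit (1 + A).det := hM.det_pos.ne'.isUnit
  have h : 1 - (1 + A)⁻¹ = (1 + A)⁻¹ * (A + Aᴴ * A) * ((1 + A)⁻¹)ᴴ := by
    rw [hM.inv.isHermitian.eq, hA.isHermitian.eq]
    have h1 : A + A * A = A * (1 + A) := by rw [mul_add, mul_one]
    rw [h1, Matrix.mul_assoc, Matrix.mul_assoc, Matrix.mul_nonsing_inv _ hu, Matrix.mul_one]
    have h2 := Matrix.nonsing_inv_mul _ hu
    rw [mul_add, mul_one] at h2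
    exact sub_eq_of_eq_add' h2.symm
  rw [h]
  exact (hA.add (posSemidef_conjTranspose_mul_self A)).mul_mul_conjTranspose_same _

/-- Writing `B = Cᴴ C`, factoring out `1 + A` leaves `det (1 + C (1 + A)⁻¹ Cᴴ)`. As `(1 + A)⁻¹ ≤ 1`,
this is at most `det (1 + C Cᴴ) = det (1 + B)`. -/
theorem det_one_add_add_le {A B : Matrix n n ℂ} (hA : A.PosSemidef) (hB : B.PosSemidef) :
    (1 + (A + B)).det ≤ (1 + A).det * (1 + B).det := by
  obtain ⟨C, rfl⟩ := exists_eq_conjTranspose_mul_self hB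
  have hM : (1 + A).PosDef := PosDef.one.add_posSemidef hA
  rw [← add_assoc, det_add_conjTranspose_mul_self hM, Matrix.det_one_add_mul_comm Cᴴ C]
  refine mul_le_mul_of_nonneg_left ?_ hM.det_pos.le
  have h : 1 + C * Cᴴ = (1 + C * (1 + A)⁻¹ * Cᴴ) + C * (1 - (1 + A)⁻¹) * Cᴴ := by
    rw [mul_sub, sub_mul, mul_one]
    abel
  rw [h]
  exact det_le_det_add
    (PosDef.one.add_posSemidef (hM.inv.posSemidef.mul_mul_conjTranspose_same C))
    ((posSemidef_one_sub_inv_one_add hA).mul_mul_conjTranspose_same C)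

theorem det_one_add_sum_le {κ : Type*} (s : Finset κ) {A : κ → Matrix n n ℂ}
    (hA : ∀ x, (A x).PosSemidef) : (1 + ∑ x ∈ s, A x).det ≤ ∏ x ∈ s, (1 + A x).det := by
  classical
  induction s using Finset.induction_on with
  | empty => simp
  | insert x s hx ih =>
    rw [Finset.sum_insert hx, Finset.prod_insert hx]
    refine (det_one_add_add_le (hA x) (posSemidef_sum s fun y _ => hA y)).trans ?_
    exact mul_le_mul_of_nonneg_left ih (zero_le_one.trans (one_le_det_one_add (hA x)))

variable {m κ : Type*} [Fintype κ] [DecidableEq κ]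

/-- The rectangular factor `V` has columns `e x ⊗ (basis vector)`, so the sum is a block diagonal
matrix conjugated by `V`. -/
theorem sum_proj_kronecker (e : κ → EuclideanSpace ℂ m) (A : κ → Matrix n n ℂ) :
    ∑ x, proj (e x) ⊗ₖ A x
      = (Matrix.of fun (i : m × n) (j : n × κ) => if i.2 = j.1 then e j.2 i.1 else 0)
        * (blockDiagonal A
          * (Matrix.of fun (i : m × n) (j : n × κ) => if i.2 = j.1 then e j.2 i.1 else 0)ᴴ) := by
  ext ⟨i, k⟩ ⟨j, l⟩
  simp only [Matrix.sum_apply, Matrix.mul_apply, kroneckerMap_apply, proj, vecMulVec_apply,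
    Matrix.of_apply, conjTranspose_apply, blockDiagonal_apply, Fintype.sum_prod_type_right,
    ite_mul, zero_mul, Finset.sum_ite_eq, Finset.mem_univ, if_true, Pi.star_apply]
  refine Finset.sum_congr rfl fun x _ => ?_
  rw [Finset.sum_eq_single x, Finset.sum_eq_single l]
  · simp
    ring
  · intro y _ hy
    simp [hy.symm]
  · simp
  · intro y _ hy
    simp [hy.symm]
  · simp

variable [Fintype m] [DecidableEq m]

/-- Orthonormality says `Vᴴ V = 1`, so `det (1 + V D Vᴴ) = det (1 + D Vᴴ V) = det (1 + D)`. No basis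
is needed: the complement of the range of `V` contributes a factor `1`. -/
theorem det_one_add_sum_proj_kronecker {e : κ → EuclideanSpace ℂ m} (he : Orthonormal ℂ e)
    (A : κ → Matrix n n ℂ) :
    (1 + ∑ x, proj (e x) ⊗ₖ A x).det = ∏ x, (1 + A x).det := by
  have hV : (Matrix.of fun (i : m × n) (j : n × κ) => if i.2 = j.1 then e j.2 i.1 else 0)ᴴ
      * (Matrix.of fun (i : m × n) (j : n × κ) => if i.2 = j.1 then e j.2 i.1 else 0) = 1 := by
    ext ⟨k, x⟩ ⟨l, y⟩
    have h := orthonormal_iff_ite.1 he x y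
    simp only [PiLp.inner_apply, RCLike.inner_apply] at h
    simp only [Matrix.mul_apply, Matrix.of_apply, conjTranspose_apply,
      Fintype.sum_prod_type, Matrix.one_apply, Prod.mk.injEq]
    by_cases hkl : k = l
    · subst hkl
      simpa [apply_ite, mul_comm] using h
    · simp [hkl, Ne.symm hkl, apply_ite]
  rw [sum_proj_kronecker, det_one_add_mul_comm, Matrix.mul_assoc, hV, Matrix.mul_one,
    ← blockDiagonal_one, ← blockDiagonal_add, det_blockDiagonal]
  rfl

theorem trace_proj {m : Type*} [Fintype m] {v : EuclideanSpace ℂ m} (hv : ‖v‖ = 1) :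
    (proj v).trace = 1 := by
  have h := inner_self_eq_norm_sq_to_K (𝕜 := ℂ) v
  rw [hv] at h
  simp only [PiLp.inner_apply, RCLike.inner_apply] at h
  simpa [proj, Matrix.trace, vecMulVec_apply] using h

end Determinant

/-! ### Comparison of a classical-quantum state with its reduced state. -/

section ClassicalQuantum

open Matrix MeasureTheory

variable {n a b : Type*} [Fintype n] [DecidableEq n] [Fintype a] [DecidableEq a] [Fintype b]
  [DecidableEq b]

theorem State.eigenvalues_nonneg (ρ : State n) (i : n) : 0 ≤ ρ.eigenvalues i :=
  ρ.posSemidef.eigenvalues_nonneg i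

theorem State.sum_eigenvalues (ρ : State n) : ∑ i, ρ.eigenvalues i = 1 := by
  have h := ρ.posSemidef.isHermitian.trace_eq_sum_eigenvalues
  rw [ρ.trace_eq_one] at h
  exact Complex.ofReal_injective (by simpa [State.eigenvalues] using h.symm)

theorem Q_eq_integralF (ρ : State n) : Q ρ = integralF ρ.eigenvalues :=
  F_eq_integralF ρ.eigenvalues_nonneg

theorem hasF_Q (ρ : State n) : HasF ρ.eigenvalues (Q ρ) := by
  rw [Q_eq_integralF]
  exact hasF_integralF ρ.eigenvalues_nonneg

theorem reduced_mat_of_eq_sum {a b κ : Type*} [Fintype a] [Fintype b] [Fintype κ]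
    {ρ : State (a × b)} {p : κ → ℂ} {e : κ → EuclideanSpace ℂ a} {σ : κ → Matrix b b ℂ} (he : ∀ x, ‖e x‖ = 1)
    (h : ρ.mat = ∑ x, p x • (proj (e x) ⊗ₖ σ x)) : ρ.reduced.mat = ∑ x, p x • σ x := by
  ext k l
  simp only [State.reduced, h, Matrix.sum_apply, submatrix_apply, Matrix.smul_apply,
    kroneckerMap_apply, smul_eq_mul]
  rw [Finset.sum_comm]
  refine Finset.sum_congr rfl fun x _ => ?_
  have ht : ∑ i, proj (e x) i i = 1 := trace_proj (he x)
  rw [← Finset.mul_sum, ← Finset.sum_mul, ht, one_mul]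

theorem IsClassicalQuantum.det_one_add_smul_reduced_le {ρ : State (a × b)}
    (hρ : IsClassicalQuantum ρ) {u : ℝ} (hu : 0 ≤ u) :
    (1 + (u : ℂ) • ρ.reduced.mat).det ≤ (1 + (u : ℂ) • ρ.mat).det := by
  obtain ⟨N, p, e, σ, hp, -, he, h⟩ := hρ
  have hA : ∀ x, (((u * p x : ℝ) : ℂ) • (σ x).mat).PosSemidef := fun x =>
    (σ x).posSemidef.smul (Complex.zero_le_real.2 (mul_nonneg hu (hp x)))
  have h1 : (u : ℂ) • ρ.reduced.mat = ∑ x, ((u * p x : ℝ) : ℂ) • (σ x).mat := by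
    rw [reduced_mat_of_eq_sum he.1 h, Finset.smul_sum]
    simp only [smul_smul, Complex.ofReal_mul]
  have h2 : (u : ℂ) • ρ.mat = ∑ x, proj (e x) ⊗ₖ (((u * p x : ℝ) : ℂ) • (σ x).mat) := by
    rw [h, Finset.smul_sum]
    simp only [smul_smul, Complex.ofReal_mul, kronecker_smul]
  rw [h1, h2, det_one_add_sum_proj_kronecker he]
  exact det_one_add_sum_le Finset.univ hA

theorem IsClassicalQuantum.integrand_reduced_le {ρ : State (a × b)}
    (hρ : IsClassicalQuantum ρ) {t : ℝ} (ht : 0 < t) :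
    integrand ρ.reduced.eigenvalues t ≤ integrand ρ.eigenvalues t := by
  have h := hρ.det_one_add_smul_reduced_le (inv_nonneg.2 ht.le)
  rw [det_one_add_inv_smul ρ.reduced.posSemidef.isHermitian ht,
    det_one_add_inv_smul ρ.posSemidef.isHermitian ht, Complex.real_le_real] at h
  have hpos : 0 < ∏ i, (1 + ρ.reduced.eigenvalues i / t) := Finset.prod_pos fun i _ => by
    have := div_nonneg (ρ.reduced.eigenvalues_nonneg i) ht.le
    linarith
  -- Both traces are one, so the `1/(1+t)` terms agree and only the inverse products remain to be
  -- compared.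
  rw [integrand, integrand, State.sum_eigenvalues, State.sum_eigenvalues]
  exact sub_le_sub_left (inv_anti₀ hpos h) _

theorem IsClassicalQuantum.condQ_nonneg {ρ : State (a × b)} (hρ : IsClassicalQuantum ρ) :
    0 ≤ condQ ρ := by
  rw [condQ, Q_eq_integralF, Q_eq_integralF, sub_nonneg]
  exact setIntegral_mono_on (integrable_integrand ρ.reduced.eigenvalues_nonneg)
    (integrable_integrand ρ.eigenvalues_nonneg) measurableSet_Ioi
    fun t ht => hρ.integrand_reduced_le ht

end ClassicalQuantum

end Subentropy

theorem mainTheorem5 {a b : Type*} [Fintype a] [DecidableEq a] [Fintype b] [DecidableEq b]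
    (ρ : Subentropy.State (a × b)) (hρ : Subentropy.IsClassicalQuantum ρ) :
    Subentropy.HasF ρ.eigenvalues (Subentropy.Q ρ) ∧
      Subentropy.HasF ρ.reduced.eigenvalues (Subentropy.Q ρ.reduced) ∧
      0 ≤ Subentropy.condQ ρ :=
  ⟨Subentropy.hasF_Q ρ, Subentropy.hasF_Q ρ.reduced, hρ.condQ_nonneg⟩
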